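/- Let $I$ be an index set with at least two elements (possibly infinite), let $(G_i)_{i\in I}$ be a family of non-trivial groups, and let $G=\ast_{i\in I}G_i$ be their free product. Every element $g\in G$ is represented by a unique reduced word $v_1v_2\cdots v_n$ ($n\ge 0$), where each $v_k$ is a non-identity element of one of the factors and, for $1\le k<n$, $v_k$ and $v_{k+1}$ lie in different factors. The element $g$ is called a palindrome if its reduced word coincides with the reversed word $v_nv_{n-1}\cdots v_1$, that is, $v_k=v_{n+1-k}$ for all $k$. The palindromes generate $G$. The palindromic width of $G$ (with respect to this free factorization) is the supremum in $\mathbb N\cup\{\infty\}$, over all $g\in G$, of the least number $k$ such that $g$ is a product of $k$ palindromes. Theorem. The palindromic width of $G$ is infinite if and only if at least one of the groups $G_i$ has more than two elements or there are at least three factors (i.e. $|I|\ge 3$). If $|I|=2$ and both factors are cyclic of order two, then the palindromic width of $G$ is equal to two. -/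

import Mathlib

/-- The length of `x` relative to `S`: the least `k` such that `x` is a product of `k` elements
of `S` (`⊤` if there is no such `k`). -/
noncomputable def lengthRel {H : Type*} [Group H] (S : Set H) (x : H) : ℕ∞ :=
  sInf {k : ℕ∞ | ∃ l : List H, (∀ y ∈ l, y ∈ S) ∧ l.prod = x ∧ k = (l.length : ℕ∞)}

/-- The width of the group `H` relative to `S`: the supremum of the lengths of its elements. -/
noncomputable def width (H : Type*) [Group H] (S : Set H) : ℕ∞ :=
  ⨆ x : H, lengthRel S x

/-- The palindromes associated with the free factorization of `Monoid.CoprodI G` into the `G i`: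
the elements whose reduced word (the sequence of its syllables) reads the same forward and
backward. -/
def palindromes {ι : Type*} (G : ι → Type*) [∀ i, Group (G i)] : Set (Monoid.CoprodI G) :=
  {g | ∃ w : Monoid.CoprodI.Word G, w.prod = g ∧ w.toList.reverse = w.toList}

/-- The palindromic width of the free product of the groups `G i`. -/
noncomputable def palindromicWidth {ι : Type*} (G : ι → Type*) [∀ i, Group (G i)] : ℕ∞ :=
  width (Monoid.CoprodI G) (palindromes G)

/-- Elements of the free factors are palindromes. -/
theorem of_mem_palindromes {ι : Type*} (G : ι → Type*) [∀ i, Group (G i)] {i : ι} (m : G i) :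
    Monoid.CoprodI.of m ∈ palindromes G := by
  by_cases h : m = 1
  · exact ⟨Monoid.CoprodI.Word.empty, by simp [h], by simp⟩
  · exact ⟨⟨[⟨i, m⟩], by simpa using h, by simp⟩, by simp [Monoid.CoprodI.Word.prod], by simp⟩

/-- The set of palindromes is closed under inversion. -/
theorem inv_mem_palindromes {ι : Type*} (G : ι → Type*) [∀ i, Group (G i)]
    {g : Monoid.CoprodI G} (hg : g ∈ palindromes G) : g⁻¹ ∈ palindromes G := by
  obtain ⟨w, rfl, hw⟩ := hg
  refine ⟨⟨w.toList.map fun l => ⟨l.1, l.2⁻¹⟩, ?_, ?_⟩, ?_, ?_⟩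
  · intro l hl
    obtain ⟨l', hl', rfl⟩ := List.mem_map.1 hl
    simpa using w.ne_one l' hl'
  · rw [List.isChain_map]
    exact w.chain_ne
  · simp only [Monoid.CoprodI.Word.prod, List.prod_inv_reverse, List.map_map]
    rw [← List.map_reverse, hw]
    congr 1
  · simp only
    rw [← List.map_reverse, hw]

/-- The palindromes generate the free product, so every element has finite length. -/
theorem lengthRel_palindromes_ne_top {ι : Type*} (G : ι → Type*) [∀ i, Group (G i)]
    (g : Monoid.CoprodI G) : lengthRel (palindromes G) g ≠ ⊤ := by
  have key : ∃ l : List (Monoid.CoprodI G), (∀ y ∈ l, y ∈ palindromes G) ∧ l.prod = g := by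
    induction g using Monoid.CoprodI.induction_left with
    | one => exact ⟨[], by simp, by simp⟩
    | mul m x ih =>
      obtain ⟨l, hl, rfl⟩ := ih
      exact ⟨Monoid.CoprodI.of m :: l, by simpa [of_mem_palindromes] using hl, by simp⟩
  obtain ⟨l, hl, hp⟩ := key
  exact ne_top_of_le_ne_top (ENat.natCast_ne_top l.length) (sInf_le ⟨l, hl, hp, rfl⟩)

/-! Infinite width comes from a quasimorphism. For a pattern `P` of `k` syllables, invariant under
inverting each syllable, `windowSum P k` changes sign under reversal, hence vanishes on palindromes,
and on reduced words it is additive up to `6 * k + 3` (`abs_windowSum_mul_sub_le`). It is therefore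
at most `(6 * k + 3) * n` on a product of `n` palindromes, and any pattern on which it is unbounded
forces infinite width. With three factors the index pattern `i, j, k` works; with distinct
non-trivial `x, y` in one factor, a pattern of run lengths two and three does.

In the infinite dihedral case syllables alternate between two letters, so odd words are palindromes
and a nonempty even word is a letter times an odd word. -/

open Monoid.CoprodI

/-! ### Counting windows up to reversal -/

section WindowSum

variable {α : Type*}

open Classical in
/-- The sign of `l` relative to `P`: `1` if only `l` satisfies `P`, `-1` if only its reverse does,
and `0` otherwise. -/
noncomputable def chiralSign (P : List α → Prop) (l : List α) : ℤ :=
  (if P l then 1 else 0) - (if P l.reverse then 1 else 0)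

theorem chiralSign_reverse (P : List α → Prop) (l : List α) :
    chiralSign P l.reverse = -chiralSign P l := by
  unfold chiralSign
  split_ifs <;> simp_all

theorem abs_chiralSign_le_one (P : List α → Prop) (l : List α) : |chiralSign P l| ≤ 1 := by
  unfold chiralSign
  split_ifs <;> simp

theorem chiralSign_eq_zero_of_length_ne {P : List α → Prop} {k : ℕ}
    (hP : ∀ l, P l → l.length = k) {l : List α} (hl : l.length ≠ k) : chiralSign P l = 0 := by
  have h1 : ¬ P l := fun h => hl (hP _ h)
  have h2 : ¬ P l.reverse := fun h => hl (by simpa using hP _ h)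
  simp [chiralSign, h1, h2]

theorem chiralSign_map {P : List α → Prop} {σ : α → α} (hσ : ∀ l, P (l.map σ) ↔ P l)
    (l : List α) : chiralSign P (l.map σ) = chiralSign P l := by
  have h1 := hσ l
  have h2 := hσ l.reverse
  rw [List.map_reverse] at h2
  unfold chiralSign
  split_ifs <;> simp_all

/-- The number of windows of length `k` in a list that satisfy `P`, minus the number of those
whose reverse does. -/
noncomputable def windowSum (P : List α → Prop) (k : ℕ) : List α → ℤ
  | [] => 0
  | a :: l => chiralSign P ((a :: l).take k) + windowSum P k l

theorem windowSum_map {P : List α → Prop} {k : ℕ} {σ : α → α}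
    (hσ : ∀ l, P (l.map σ) ↔ P l) (l : List α) :
    windowSum P k (l.map σ) = windowSum P k l := by
  induction l with
  | nil => rfl
  | cons a l ih =>
    simp only [List.map_cons, windowSum, ih]
    rw [← List.map_cons, ← List.map_take, chiralSign_map hσ]

/-- The only new full window is the one ending at `a`; reading it backwards from `a` changes the
sign. -/
theorem windowSum_concat {P : List α → Prop} {k : ℕ} (hP : ∀ l, P l → l.length = k)
    (a : α) (l : List α) :
    windowSum P k (l ++ [a]) = windowSum P k l - chiralSign P ((a :: l.reverse).take k) := by
  induction l with
  | nil =>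
    have h : (([a] : List α).take k).reverse = [a].take k := by cases k <;> simp
    have := chiralSign_reverse P ([a].take k)
    rw [h] at this
    simp only [List.nil_append, List.reverse_nil, windowSum]
    omega
  | cons b l ih =>
    simp only [List.cons_append, windowSum, ih, List.reverse_cons]
    rcases le_or_gt k (l.length + 1) with hk | hk
    · have h1 : (b :: (l ++ [a])).take k = (b :: l).take k := by
        rw [← List.cons_append, List.take_append_of_le_length (by simpa using hk)]
      have h2 : (a :: (l.reverse ++ [b])).take k = (a :: l.reverse).take k := by
        rw [← List.cons_append, List.take_append_of_le_length (by simpa using hk)]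
      rw [h1, h2]
      ring
    · have h1 : (b :: (l ++ [a])).take k = b :: (l ++ [a]) :=
        List.take_of_length_le (by simp; omega)
      have h2 : (a :: (l.reverse ++ [b])).take k = (b :: (l ++ [a])).reverse := by
        rw [List.take_of_length_le (by simp; omega)]
        simp
      have h3 : chiralSign P ((b :: l).take k) = 0 :=
        chiralSign_eq_zero_of_length_ne hP (by simp; omega)
      have h4 : chiralSign P ((a :: l.reverse).take k) = 0 :=
        chiralSign_eq_zero_of_length_ne hP (by simp; omega)
      rw [h1, h2, h3, h4, chiralSign_reverse]
      ring

theorem windowSum_reverse {P : List α → Prop} {k : ℕ} (hP : ∀ l, P l → l.length = k)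
    (l : List α) : windowSum P k l.reverse = -windowSum P k l := by
  induction l with
  | nil => rfl
  | cons a l ih =>
    rw [List.reverse_cons, windowSum_concat hP, ih, List.reverse_reverse, windowSum]
    ring

theorem abs_windowSum_append_sub_le {P : List α → Prop} {k : ℕ} (hP : ∀ l, P l → l.length = k)
    (u v : List α) :
    |windowSum P k (u ++ v) - windowSum P k u - windowSum P k v| ≤ (k : ℤ) := by
  -- Only windows starting among the last `k` letters of `u` can cross the junction; the `min` lets
  -- the induction stop accumulating error beyond them.
  suffices h : |windowSum P k (u ++ v) - windowSum P k u - windowSum P k v| ≤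
      (min u.length k : ℕ) from h.trans (by exact_mod_cast min_le_right _ _)
  induction u with
  | nil => simp [windowSum]
  | cons a u ih =>
    simp only [List.cons_append, windowSum]
    rcases le_or_gt k (u.length + 1) with hk | hk
    · have h1 : (a :: (u ++ v)).take k = (a :: u).take k := by
        rw [← List.cons_append, List.take_append_of_le_length (by simpa using hk)]
      have h2 : min u.length k ≤ min (a :: u).length k := by grind
      rw [h1]
      zify at h2
      push_cast at ih ⊢
      rw [abs_le] at ih ⊢
      constructor <;> linarith
    · have h1 : chiralSign P ((a :: u).take k) = 0 :=
        chiralSign_eq_zero_of_length_ne hP (by simp; omega)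
      have h2 := abs_chiralSign_le_one P ((a :: (u ++ v)).take k)
      rw [min_eq_left (by simp; omega)]
      rw [min_eq_left (by omega)] at ih
      rw [h1]
      rw [List.length_cons]
      push_cast
      rw [abs_le] at *
      constructor <;> linarith

theorem abs_windowSum_le_length (P : List α → Prop) (k : ℕ) (l : List α) :
    |windowSum P k l| ≤ l.length := by
  induction l with
  | nil => simp [windowSum]
  | cons a l ih =>
    have := abs_chiralSign_le_one P ((a :: l).take k)
    rw [windowSum, List.length_cons]
    push_cast
    exact (abs_add_le _ _).trans (by linarith)

end WindowSum

/-! ### Reduced words and the quasimorphism bound -/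

section Reduced

variable {ι : Type*} {G : ι → Type*} [∀ i, Group (G i)]

/-- The reduced words, as lists of syllables. -/
def IsReducedWord (L : List (Σ i, G i)) : Prop :=
  (∀ l ∈ L, l.2 ≠ 1) ∧ L.IsChain (fun l l' => l.1 ≠ l'.1)

/-- The product of a list of syllables. -/
def syllableProd (L : List (Σ i, G i)) : Monoid.CoprodI G :=
  (L.map fun l => of l.2).prod

/-- The inverse of a syllable. -/
def syllableInv (l : Σ i, G i) : Σ i, G i := ⟨l.1, l.2⁻¹⟩

theorem Monoid.CoprodI.Word.isReducedWord (w : Word G) : IsReducedWord w.toList :=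
  ⟨w.ne_one, w.chain_ne⟩

theorem exists_isReducedWord (g : Monoid.CoprodI G) :
    ∃ L : List (Σ i, G i), IsReducedWord L ∧ syllableProd L = g := by
  classical
  exact ⟨(Word.equiv g).toList, Word.isReducedWord _, Word.equiv.symm_apply_apply g⟩

theorem IsReducedWord.eq_of_syllableProd_eq {L L' : List (Σ i, G i)} (hL : IsReducedWord L)
    (hL' : IsReducedWord L') (h : syllableProd L = syllableProd L') : L = L' := by
  classical
  have : (⟨L, hL.1, hL.2⟩ : Word G) = ⟨L', hL'.1, hL'.2⟩ := Word.equiv.symm.injective h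
  exact congrArg Word.toList this

theorem IsReducedWord.syllableProd_mem_palindromes_iff {L : List (Σ i, G i)}
    (hL : IsReducedWord L) : syllableProd L ∈ palindromes G ↔ L.reverse = L := by
  constructor
  · rintro ⟨w, hw, hr⟩
    rwa [hL.eq_of_syllableProd_eq w.isReducedWord hw.symm]
  · intro h
    exact ⟨⟨L, hL.1, hL.2⟩, rfl, h⟩

theorem isReducedWord_cons {l : Σ i, G i} {L : List (Σ i, G i)} :
    IsReducedWord (l :: L) ↔ l.2 ≠ 1 ∧ (∀ l' ∈ L.head?, l.1 ≠ l'.1) ∧ IsReducedWord L := by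
  simp only [IsReducedWord, List.forall_mem_cons, List.isChain_cons]
  tauto

theorem isReducedWord_append {L L' : List (Σ i, G i)} :
    IsReducedWord (L ++ L') ↔ IsReducedWord L ∧ IsReducedWord L' ∧
      ∀ l ∈ L.getLast?, ∀ l' ∈ L'.head?, l.1 ≠ l'.1 := by
  simp only [IsReducedWord, List.forall_mem_append, List.isChain_append]
  tauto

/-- Here `c` is the part that cancels completely, after which at most one pair of syllables `s`, `t`
merges into `r`. -/
theorem IsReducedWord.exists_mul_decomposition {L L' : List (Σ i, G i)} (hL : IsReducedWord L)
    (hL' : IsReducedWord L') :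
    ∃ u s c t v r : List (Σ i, G i), L = u ++ (s ++ c) ∧
      L' = (c.map syllableInv).reverse ++ (t ++ v) ∧ IsReducedWord (u ++ (r ++ v)) ∧
      syllableProd (u ++ (r ++ v)) = syllableProd L * syllableProd L' ∧
      s.length ≤ 1 ∧ t.length ≤ 1 ∧ r.length ≤ 1 := by
  induction L using List.reverseRecOn generalizing L' with
  | nil =>
    exact ⟨[], [], [], [], L', [], by simp, by simp, by simpa using hL', by simp [syllableProd],
      by simp, by simp, by simp⟩
  | append_singleton M l ih =>
    rcases L' with _ | ⟨l', M'⟩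
    · exact ⟨M ++ [l], [], [], [], [], [], by simp, by simp, by simpa using hL,
        by simp [syllableProd], by simp, by simp, by simp⟩
    have hM := (isReducedWord_append.1 hL).1
    have hM' := (isReducedWord_cons.1 hL').2.2
    by_cases hi : l.1 = l'.1
    · obtain ⟨i, m⟩ := l
      obtain ⟨j, m'⟩ := l'
      obtain rfl : i = j := hi
      by_cases hm : m * m' = 1
      · obtain ⟨u, s, c, t, v, r, rfl, rfl, hr, hp, hs⟩ := ih hM hM'
        obtain rfl : m' = m⁻¹ := (inv_eq_of_mul_eq_one_right hm).symm
        refine ⟨u, s, c ++ [⟨i, m⟩], t, v, r, by simp, by simp [syllableInv], hr, ?_, hs⟩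
        rw [hp]
        simp [syllableProd, mul_assoc]
      · refine ⟨M, [⟨i, m⟩], [], [⟨i, m'⟩], M', [⟨i, m * m'⟩], by simp, by simp, ?_,
          by simp [syllableProd, mul_assoc], by simp, by simp, by simp⟩
        rw [isReducedWord_append] at hL ⊢
        rw [isReducedWord_cons] at hL'
        refine ⟨hM, ?_, by simpa using hL.2.2⟩
        exact isReducedWord_cons.2 ⟨hm, hL'.2.1, hM'⟩
    · refine ⟨M ++ [l], [], [], [], l' :: M', [], by simp, by simp, ?_,
        by simp [syllableProd, mul_assoc], by simp, by simp, by simp⟩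
      exact isReducedWord_append.2 ⟨hL, hL', by simpa using hi⟩

theorem abs_windowSum_mul_sub_le {P : List (Σ i, G i) → Prop} {k : ℕ}
    (hP : ∀ l, P l → l.length = k) (hinv : ∀ l, P (l.map syllableInv) ↔ P l)
    {L L' L'' : List (Σ i, G i)} (hL : IsReducedWord L) (hL' : IsReducedWord L')
    (hL'' : IsReducedWord L'') (h : syllableProd L'' = syllableProd L * syllableProd L') :
    |windowSum P k L'' - windowSum P k L - windowSum P k L'| ≤ 6 * k + 3 := by
  obtain ⟨u, s, c, t, v, r, rfl, rfl, hr, hp, hs, ht, hr1⟩ := hL.exists_mul_decomposition hL'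
  obtain rfl := hL''.eq_of_syllableProd_eq hr (h.trans hp.symm)
  have e1 := abs_windowSum_append_sub_le hP u (r ++ v)
  have e2 := abs_windowSum_append_sub_le hP r v
  have e3 := abs_windowSum_append_sub_le hP u (s ++ c)
  have e4 := abs_windowSum_append_sub_le hP s c
  have e5 := abs_windowSum_append_sub_le hP (c.map syllableInv).reverse (t ++ v)
  have e6 := abs_windowSum_append_sub_le hP t v
  have b1 := abs_windowSum_le_length P k s
  have b2 := abs_windowSum_le_length P k t
  have b3 := abs_windowSum_le_length P k r
  -- The two copies of `c` now contribute opposite values. What remains is six junctions, each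
  -- costing `k`, and three pieces of length at most one.
  rw [windowSum_reverse hP, windowSum_map hinv] at e5
  zify at hs ht hr1
  rw [abs_le] at *
  constructor <;> linarith

theorem IsReducedWord.abs_windowSum_le_of_palindromes {P : List (Σ i, G i) → Prop} {k : ℕ}
    (hP : ∀ l, P l → l.length = k) (hinv : ∀ l, P (l.map syllableInv) ↔ P l)
    (ps : List (Monoid.CoprodI G)) (hps : ∀ p ∈ ps, p ∈ palindromes G)
    {L : List (Σ i, G i)} (hL : IsReducedWord L) (h : syllableProd L = ps.prod) :
    |windowSum P k L| ≤ (6 * k + 3) * ps.length := by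
  induction ps generalizing L with
  | nil =>
    have : L = [] := hL.eq_of_syllableProd_eq ⟨by simp, by simp⟩ (by simpa [syllableProd] using h)
    simp [this, windowSum]
  | cons p ps ih =>
    obtain ⟨w, hw, hr⟩ := hps p (by simp)
    obtain ⟨M, hM, hMp⟩ := exists_isReducedWord ps.prod
    have h1 := ih (fun p hp => hps p (by simp [hp])) hM hMp
    -- A palindrome's value equals its own negative.
    have h0 : windowSum P k w.toList = 0 := by
      have := windowSum_reverse hP w.toList
      rw [hr] at this
      omega
    have h2 := abs_windowSum_mul_sub_le hP hinv w.isReducedWord hM hL (by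
      rw [h, List.prod_cons, hMp, ← hw]; rfl)
    rw [h0] at h2
    rw [List.length_cons]
    push_cast
    rw [abs_le] at *
    constructor <;> linarith

theorem exists_list_of_lengthRel_le {H : Type*} [Group H] {S : Set H} {x : H} {n : ℕ}
    (h : lengthRel S x ≤ n) : ∃ l : List H, (∀ y ∈ l, y ∈ S) ∧ l.prod = x ∧ l.length ≤ n := by
  have hlt : lengthRel S x < (n : ℕ∞) + 1 :=
    lt_of_le_of_lt h (by exact_mod_cast Nat.lt_succ_self n)
  obtain ⟨k, ⟨l, hl, hp, rfl⟩, hk⟩ := sInf_lt_iff.1 hlt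
  exact ⟨l, hl, hp, by exact Nat.lt_succ_iff.1 (by exact_mod_cast hk)⟩

theorem palindromicWidth_eq_top_of_windowSum {P : List (Σ i, G i) → Prop} {k : ℕ}
    (hP : ∀ l, P l → l.length = k) (hinv : ∀ l, P (l.map syllableInv) ↔ P l)
    (hunb : ∀ n : ℕ, ∃ L, IsReducedWord L ∧ (n : ℤ) ≤ windowSum P k L) :
    palindromicWidth G = ⊤ := by
  by_contra hne
  obtain ⟨N, hN⟩ := ENat.ne_top_iff_exists.1 hne
  obtain ⟨L, hL, hLn⟩ := hunb ((6 * k + 3) * N + 1)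
  obtain ⟨ps, hps, hprod, hlen⟩ := exists_list_of_lengthRel_le (S := palindromes G)
    (x := syllableProd L) (n := N) (hN ▸ le_iSup (lengthRel (palindromes G)) _)
  have h1 := hL.abs_windowSum_le_of_palindromes hP hinv ps hps hprod.symm
  have h2 : ((6 * k + 3) * ps.length : ℤ) ≤ (6 * k + 3) * N := by gcongr
  have h3 := le_abs_self (windowSum P k L)
  push_cast at hLn
  linarith

end Reduced

/-! ### Words with unbounded window sums -/

section Patterns

theorem le_windowSum_of_three_indices {ι : Type*} {G : ι → Type*} {i j k : ι}
    (hij : i ≠ j) (hjk : j ≠ k) (hik : i ≠ k)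
    (a : G i) (b : G j) (c : G k) (n : ℕ) :
    (n : ℤ) ≤ windowSum (fun l : List (Σ i, G i) => l.map Sigma.fst = [i, j, k]) 3
      (List.replicate n [(⟨i, a⟩ : Σ i, G i), ⟨j, b⟩, ⟨k, c⟩]).flatten := by
  induction n with
  | zero => simp [windowSum]
  | succ n ih =>
    -- Windows reach into the next period, so the last period is treated apart: its overhanging
    -- windows are too short to count.
    cases n <;>
    simp [List.replicate_succ, windowSum, chiralSign, hij, hjk, hik, hij.symm, hjk.symm,
      hik.symm] at ih ⊢
    linarith

variable {ι : Type*} {G : ι → Type*} [∀ i, Group (G i)]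

theorem IsReducedWord.flatten_replicate {U : List (Σ i, G i)} (hU : IsReducedWord (U ++ U))
    (hne : U ≠ []) (n : ℕ) : IsReducedWord (List.replicate n U).flatten := by
  induction n with
  | zero => exact ⟨by simp, by simp⟩
  | succ n ih =>
    rw [isReducedWord_append] at hU
    rw [List.replicate_succ, List.flatten_cons, isReducedWord_append]
    refine ⟨hU.1, ih, ?_⟩
    cases n with
    | zero => simp
    | succ n =>
      rw [List.replicate_succ, List.flatten_cons, List.head?_append_of_ne_nil _ hne]
      exact hU.2.2

theorem palindromicWidth_eq_top_of_three_indices [∀ i, Nontrivial (G i)] {i j k : ι}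
    (hij : i ≠ j) (hjk : j ≠ k) (hik : i ≠ k) : palindromicWidth G = ⊤ := by
  obtain ⟨a, ha⟩ := exists_ne (1 : G i)
  obtain ⟨b, hb⟩ := exists_ne (1 : G j)
  obtain ⟨c, hc⟩ := exists_ne (1 : G k)
  refine palindromicWidth_eq_top_of_windowSum
    (P := fun l : List (Σ i, G i) => l.map Sigma.fst = [i, j, k]) (k := 3) ?_ ?_ fun n =>
      ⟨_, IsReducedWord.flatten_replicate ?_ ?_ n, le_windowSum_of_three_indices hij hjk hik a b c n⟩
  · intro l hl
    simpa using congrArg List.length hl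
  · intro l
    simp [Function.comp_def, syllableInv]
  · simp [IsReducedWord, ha, hb, hc, hij, hjk, hik.symm]
  · simp

/-- The lists of nine entries whose odd entries are of the form `x, x, y, y, y` with `x ≠ y`. -/
def IsTwoThreeRun {α : Type*} (l : List α) : Prop :=
  l.length = 9 ∧ l[0]? = l[2]? ∧ l[2]? ≠ l[4]? ∧ l[4]? = l[6]? ∧ l[6]? = l[8]?

/-- The pattern involves only equalities between entries. Naming `x` and `y` would break invariance
under inversion, for instance when `y = x⁻¹`. -/
theorem isTwoThreeRun_map {α : Type*} {σ : α → α} (hσ : σ.Injective) (l : List α) :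
    IsTwoThreeRun (l.map σ) ↔ IsTwoThreeRun l := by
  simp only [IsTwoThreeRun, List.length_map, List.getElem?_map, ne_eq,
    (Option.map_injective hσ).eq_iff]

open Classical in
theorem chiralSign_isTwoThreeRun {α : Type*} (a b c d e f g h i : α) :
    chiralSign IsTwoThreeRun [a, b, c, d, e, f, g, h, i] =
      (if a = c ∧ c ≠ e ∧ e = g ∧ g = i then 1 else 0) -
        (if i = g ∧ g ≠ e ∧ e = c ∧ c = a then 1 else 0) := by
  simp [chiralSign, IsTwoThreeRun]

theorem chiralSign_isTwoThreeRun_of_length_ne {α : Type*} {l : List α} (hl : l.length ≠ 9) :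
    chiralSign IsTwoThreeRun l = 0 :=
  chiralSign_eq_zero_of_length_ne (fun _ h => h.1) hl

/-- Without the separators `b`, the period is `x y y x x x y`, with runs of lengths 1, 2, 3, 1: a
run of two precedes the run of three, but a single `y` follows it, so the reversed pattern never
occurs. -/
theorem le_windowSum_isTwoThreeRun {α : Type*} {x y : α} (hxy : x ≠ y) (b : α) (n : ℕ) :
    (n : ℤ) ≤ windowSum IsTwoThreeRun 9
      (List.replicate n [x, b, y, b, y, b, x, b, x, b, x, b, y, b]).flatten := by
  induction n with
  | zero => simp [windowSum]
  | succ n ih =>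
    rw [List.replicate_succ, List.flatten_cons]
    generalize hM : (List.replicate n [x, b, y, b, y, b, x, b, x, b, x, b, y, b]).flatten = M at *
    simp only [List.cons_append, List.nil_append, windowSum, List.take_succ_cons, List.take_zero,
      chiralSign_isTwoThreeRun]
    cases n with
    | zero =>
      subst hM
      simp [windowSum, chiralSign_isTwoThreeRun_of_length_ne, hxy, hxy.symm]
    | succ n =>
      rw [List.replicate_succ, List.flatten_cons] at hM
      simp only [List.cons_append, List.nil_append] at hM
      rw [← hM] at ih ⊢
      simp only [List.take_succ_cons, List.take_zero, chiralSign_isTwoThreeRun]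
      simp only [hxy, hxy.symm, ne_eq, not_true_eq_false, not_false_eq_true, and_true, and_false,
        if_true, if_false]
      push_cast at ih ⊢
      linarith

theorem palindromicWidth_eq_top_of_two_lt_card [Nontrivial ι] [∀ i, Nontrivial (G i)] {i : ι}
    {x y : G i} (hx : x ≠ 1) (hy : y ≠ 1) (hxy : x ≠ y) : palindromicWidth G = ⊤ := by
  obtain ⟨j, hj⟩ := exists_ne i
  obtain ⟨b, hb⟩ := exists_ne (1 : G j)
  have hxy' : (⟨i, x⟩ : Σ i, G i) ≠ ⟨i, y⟩ := by simpa using hxy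
  refine palindromicWidth_eq_top_of_windowSum (P := IsTwoThreeRun) (k := 9) (fun l hl => hl.1) ?_
    fun n => ⟨_, IsReducedWord.flatten_replicate ?_ ?_ n,
      le_windowSum_isTwoThreeRun hxy' (⟨j, b⟩ : Σ i, G i) n⟩
  · refine isTwoThreeRun_map (Function.LeftInverse.injective (g := syllableInv) fun l => ?_)
    exact Sigma.ext rfl (by simp [syllableInv])
  · simp [IsReducedWord, hx, hy, hb, hj, hj.symm]
  · simp

end Patterns

/-! ### Two factors of order two -/

section Dihedral

variable {ι : Type*} {G : ι → Type*} [∀ i, Group (G i)]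

theorem IsReducedWord.getElem_add_two {L : List (Σ i, G i)} (hL : IsReducedWord L)
    (hι : ∀ i j k : ι, i ≠ j → j ≠ k → i = k) (hG : ∀ i, ∀ x y : G i, x ≠ 1 → y ≠ 1 → x = y)
    (n : ℕ) (hn : n + 2 < L.length) : L[n + 2] = L[n] := by
  have hc := List.isChain_iff_getElem.1 hL.2
  have h := (hι _ _ _ (hc n (by omega)) (hc (n + 1) (by omega))).symm
  have h1 := hL.1 _ (List.getElem_mem hn)
  have h2 := hL.1 _ (List.getElem_mem (show n < L.length by omega))
  generalize L[n + 2] = p at *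
  generalize L[n] = q at *
  obtain ⟨i, x⟩ := p
  obtain ⟨j, y⟩ := q
  obtain rfl : i = j := h
  rw [hG i x y h1 h2]

theorem IsReducedWord.getElem_add_two_mul {L : List (Σ i, G i)} (hL : IsReducedWord L)
    (hι : ∀ i j k : ι, i ≠ j → j ≠ k → i = k) (hG : ∀ i, ∀ x y : G i, x ≠ 1 → y ≠ 1 → x = y)
    (n m : ℕ) (hn : n + 2 * m < L.length) : L[n + 2 * m] = L[n] := by
  induction m with
  | zero => rfl
  | succ m ih =>
    rw [← ih (by omega)]
    exact hL.getElem_add_two hι hG (n + 2 * m) hn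

theorem IsReducedWord.reverse_eq_of_odd {L : List (Σ i, G i)} (hL : IsReducedWord L)
    (hι : ∀ i j k : ι, i ≠ j → j ≠ k → i = k) (hG : ∀ i, ∀ x y : G i, x ≠ 1 → y ≠ 1 → x = y)
    (hodd : Odd L.length) : L.reverse = L := by
  obtain ⟨m, hm⟩ := hodd
  refine List.ext_getElem (by simp) fun n h1 h2 => ?_
  rw [List.getElem_reverse]
  -- As the length is `2 * m + 1`, mirror positions `n` and `2 * m - n` have the same parity.
  rcases le_total n (L.length - 1 - n) with h | h
  · have := hL.getElem_add_two_mul hι hG n (m - n) (by omega)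
    rw [← this]
    congr 1
    omega
  · have := hL.getElem_add_two_mul hι hG (L.length - 1 - n) (n - m) (by omega)
    rw [← this]
    congr 1
    omega

theorem lengthRel_le_of_list {H : Type*} [Group H] {S : Set H} {x : H} (l : List H)
    (hl : ∀ y ∈ l, y ∈ S) (hx : l.prod = x) : lengthRel S x ≤ l.length :=
  sInf_le ⟨l, hl, hx, rfl⟩

theorem palindromicWidth_le_two (hι : ∀ i j k : ι, i ≠ j → j ≠ k → i = k)
    (hG : ∀ i, ∀ x y : G i, x ≠ 1 → y ≠ 1 → x = y) : palindromicWidth G ≤ 2 := by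
  refine iSup_le fun g => ?_
  obtain ⟨L, hL, rfl⟩ := exists_isReducedWord g
  rcases L with _ | ⟨l, M⟩
  · exact (lengthRel_le_of_list [] (by simp) (by simp [syllableProd])).trans (by simp)
  have hpal {L : List (Σ i, G i)} (hL : IsReducedWord L) (h : Odd L.length) :
      syllableProd L ∈ palindromes G :=
    hL.syllableProd_mem_palindromes_iff.2 (hL.reverse_eq_of_odd hι hG h)
  rcases Nat.even_or_odd M.length with he | ho
  · refine (lengthRel_le_of_list [syllableProd (l :: M)] ?_ (by simp)).trans (by simp)
    simpa using hpal hL (by simpa using he.add_one)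
  · refine (lengthRel_le_of_list [of l.2, syllableProd M] ?_ ?_).trans (by simp)
    · simpa using ⟨of_mem_palindromes G l.2, hpal (isReducedWord_cons.1 hL).2.2 ho⟩
    · simp [syllableProd]

theorem two_le_palindromicWidth [Nontrivial ι] [∀ i, Nontrivial (G i)] :
    2 ≤ palindromicWidth G := by
  obtain ⟨i, j, hij⟩ := exists_pair_ne ι
  obtain ⟨a, ha⟩ := exists_ne (1 : G i)
  obtain ⟨b, hb⟩ := exists_ne (1 : G j)
  have hL : IsReducedWord [(⟨i, a⟩ : Σ i, G i), ⟨j, b⟩] := by simp [IsReducedWord, ha, hb, hij]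
  refine le_trans ?_ (le_iSup (lengthRel (palindromes G)) (syllableProd [⟨i, a⟩, ⟨j, b⟩]))
  by_contra! hlt
  obtain ⟨ps, hps, hprod, hlen⟩ := exists_list_of_lengthRel_le (n := 1)
    (ENat.lt_add_one_iff (by simp) |>.1 (by simpa [one_add_one_eq_two] using hlt))
  have hmem : syllableProd [(⟨i, a⟩ : Σ i, G i), ⟨j, b⟩] ∈ palindromes G := by
    -- A product of at most one palindrome is a palindrome, the empty product being `1`.
    rcases ps with _ | ⟨p, _ | ⟨q, ps⟩⟩
    · rw [← hprod]
      simpa using of_mem_palindromes G (1 : G i)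
    · rw [← hprod]
      simpa using hps
    · simp at hlen
  rw [hL.syllableProd_mem_palindromes_iff] at hmem
  simp at hmem
  exact hij hmem.1.1.symm

end Dihedral

/-! ### Cardinality conditions and the main theorem -/

theorem ENat.three_le_card_iff {α : Type*} :
    3 ≤ ENat.card α ↔ ∃ a b c : α, a ≠ b ∧ b ≠ c ∧ a ≠ c := by
  constructor
  · intro h
    rw [← Set.encard_univ] at h
    obtain ⟨t, -, ht⟩ := Set.exists_subset_encard_eq h
    obtain ⟨a, b, c, hab, hac, hbc, -⟩ := Set.encard_eq_three.1 ht
    exact ⟨a, b, c, hab, hbc, hac⟩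
  · rintro ⟨a, b, c, hab, hbc, hac⟩
    rw [← Set.encard_univ, ← Set.encard_eq_three.2 ⟨a, b, c, hab, hac, hbc, rfl⟩]
    exact Set.encard_le_encard (Set.subset_univ _)

theorem ENat.two_lt_card_iff {α : Type*} :
    2 < ENat.card α ↔ ∃ a b c : α, a ≠ b ∧ b ≠ c ∧ a ≠ c := by
  rw [← ENat.three_le_card_iff, ← ENat.add_one_le_iff (by simp), two_add_one_eq_three]

theorem exists_ne_one_of_two_lt_card {H : Type*} [Group H] (h : 2 < ENat.card H) :
    ∃ x y : H, x ≠ 1 ∧ y ≠ 1 ∧ x ≠ y := by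
  obtain ⟨a, b, c, hab, hbc, hac⟩ := ENat.two_lt_card_iff.1 h
  by_cases ha : a = 1
  · exact ⟨b, c, by grind, by grind, hbc⟩
  by_cases hb : b = 1
  · exact ⟨a, c, ha, by grind, hac⟩
  · exact ⟨a, b, ha, hb, hab⟩

theorem palindromicWidth_eq_two {ι : Type*} [Nontrivial ι] (G : ι → Type*) [∀ i, Group (G i)]
    [∀ i, Nontrivial (G i)] (hι : ¬ 3 ≤ ENat.card ι) (hG : ∀ i, ¬ 2 < ENat.card (G i)) :
    palindromicWidth G = 2 := by
  rw [ENat.three_le_card_iff] at hι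
  simp only [ENat.two_lt_card_iff] at hG
  push Not at hι hG
  refine le_antisymm (palindromicWidth_le_two hι ?_) two_le_palindromicWidth
  intro i x y hx hy
  exact hG i x 1 y hx hy.symm

theorem mainTheorem1 {ι : Type*} [Nontrivial ι] (G : ι → Type*) [∀ i, Group (G i)]
    [∀ i, Nontrivial (G i)] :
    (palindromicWidth G = ⊤ ↔ (∃ i, 2 < ENat.card (G i)) ∨ 3 ≤ ENat.card ι) ∧
    (ENat.card ι = 2 → (∀ i, ENat.card (G i) = 2) → palindromicWidth G = 2) := by
  refine ⟨⟨fun h => ?_, ?_⟩, fun hι hG => palindromicWidth_eq_two G ?_ fun i => by simp [hG]⟩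
  · by_contra! hcon
    have := palindromicWidth_eq_two G hcon.2.not_ge fun i => (hcon.1 i).not_gt
    simp [this] at h
  · rintro (⟨i, hi⟩ | h)
    · obtain ⟨x, y, hx, hy, hxy⟩ := exists_ne_one_of_two_lt_card hi
      exact palindromicWidth_eq_top_of_two_lt_card hx hy hxy
    · obtain ⟨i, j, k, hij, hjk, hik⟩ := ENat.three_le_card_iff.1 h
      exact palindromicWidth_eq_top_of_three_indices hij hjk hik
  · rw [hι]
    decide
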